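/- Let $\xi_1,\xi_2,\ldots$ be independent nonnegative random variables with distribution functions $F_{\xi_1},F_{\xi_2},\ldots$, and let $\eta$ be a counting random variable, i.e. a random variable with values in $\{0,1,2,\ldots\}$ that is not almost surely zero, independent of the sequence $(\xi_k)_{k\ge1}$. For a distribution function $F$ write $\overline F=1-F$; $F$ is called $\mathcal O$-exponential, $F\in\mathcal{OL}$, if $$0<\liminf_{x\to\infty}\frac{\overline F(x+a)}{\overline F(x)}\le\limsup_{x\to\infty}\frac{\overline F(x+a)}{\overline F(x)}<\infty\qquad\text{for all }a\in\mathbb R.$$ Let $\operatorname{supp}(\eta)=\{n\ge0:\mathbb P(\eta=n)>0\}$ and $S_\eta=\sum_{k=1}^{\eta}\xi_k$ (with $S_\eta=0$ when $\eta=0$). Suppose that the following five conditions hold. 1. For some $\kappa\in\operatorname{supp}(\eta)\setminus\{0\}$ (which is the $\kappa$ of the other conditions), $F_{\xi_\kappa}\in\mathcal{OL}$. 2. For each $k\in\operatorname{supp}(\eta)$ with $1\le k\le\kappa$, either $\lim_{x\to\infty}\overline F_{\xi_k}(x)/\overline F_{\xi_\kappa}(x)=0$ or $F_{\xi_k}\in\mathcal{OL}$.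 3. $\displaystyle\limsup_{x\to\infty}\,\sup_{k\ge1}\frac{\overline F_{\xi_{\kappa+k}}(x-1)}{\overline F_{\xi_{\kappa+k}}(x)}<\infty$, where $c/0=\infty$ for $c>0$ and $0/0=0$. 4. $\displaystyle\limsup_{k\to\infty}\frac1k\sum_{l=1}^{k}\,\sup_{x\ge0}\bigl(\overline F_{\xi_{\kappa+l}}(x-1)-\overline F_{\xi_{\kappa+l}}(x)\bigr)<1$. 5. For each $\delta\in(0,1)$, $\overline F_\eta(\delta x)=O\bigl(\sqrt x\,\overline F_{\xi_\kappa}(x)\bigr)$ as $x\to\infty$. Then the distribution function $F_{S_\eta}$ of the random sum $S_\eta$ belongs to $\mathcal{OL}$. -/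

import Mathlib

open Filter Topology MeasureTheory ProbabilityTheory Asymptotics
open scoped ENNReal

noncomputable section

/-- The distribution function `F_X(x) = P(X ≤ x)` of a real random variable `X`. -/
def distFun {Ω : Type*} [MeasurableSpace Ω] (μ : Measure Ω) (X : Ω → ℝ) : ℝ → ℝ :=
  fun x => cdf (μ.map X) x

/-- The tail `1 - F(x)` of a distribution function. -/
def tail (F : ℝ → ℝ) (x : ℝ) : ℝ := 1 - F x

/-- The quotient of the values of the tail of `F` at `y` and at `x`, as an extended nonnegative
number: it is `∞` if only the denominator vanishes (and, by convention, `0` for `0 / 0`). -/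
def tailRatio (F : ℝ → ℝ) (y x : ℝ) : ℝ≥0∞ :=
  ENNReal.ofReal (tail F y) / ENNReal.ofReal (tail F x)

/-- The class of `O`-exponential distribution functions: for every real `a`, the lower and upper
limits at infinity of the quotients of the tail at `x + a` and at `x` are positive and finite. -/
def IsOExponential (F : ℝ → ℝ) : Prop :=
  ∀ a : ℝ, 0 < liminf (fun x : ℝ => tailRatio F (x + a) x) atTop ∧
    liminf (fun x : ℝ => tailRatio F (x + a) x) atTop ≤
      limsup (fun x : ℝ => tailRatio F (x + a) x) atTop ∧
    limsup (fun x : ℝ => tailRatio F (x + a) x) atTop < ∞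

/-- A counting random variable: nonnegative, integer-valued, and not almost surely zero. -/
structure IsCountingVariable {Ω : Type*} [MeasurableSpace Ω] (μ : Measure Ω) (η : Ω → ℕ) :
    Prop where
  measurable : Measurable η
  nondegenerate : μ {ω | η ω = 0} ≠ 1

/-- The support of a counting random variable. -/
def countingSupp {Ω : Type*} [MeasurableSpace Ω] (μ : Measure Ω) (η : Ω → ℕ) : Set ℕ :=
  {n | 0 < μ {ω | η ω = n}}

/-- The random sum `ξ₁ + ⋯ + ξ_η` (equal to `0` where `η = 0`); `ξ 0` plays no role. -/
def randomSum {Ω : Type*} (ξ : ℕ → Ω → ℝ) (η : Ω → ℕ) : Ω → ℝ :=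
  fun ω => ∑ k ∈ Finset.Icc 1 (η ω), ξ k ω

end

/-! Membership in the class amounts to unbounded support together with, for each shift `a`, a bound
`P(X > x) ≤ C P(X > x + a)` valid for all real `x`. Conditioning on an independent `Y` shows that
this bound passes to `X + Y` with the same `C` (`measure_lt_add_le_of_indepFun`). So all partial
sums of at least `κ` terms share the constant of `ξ κ`; the shorter ones lie below the `κ`-th by
nonnegativity, and its tail is at most that of the random sum divided by `P(η = κ)`. Averaging over
`η` gives `tailShiftBounded_randomSum`. -/

/-- The tail of `X` loses at most a constant factor under each shift. -/
def TailShiftBounded {Ω : Type*} [MeasurableSpace Ω] (μ : Measure Ω) (X : Ω → ℝ) : Prop :=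
  ∀ a : ℝ, ∃ C : ℝ≥0∞, C ≠ ∞ ∧ ∀ x : ℝ, μ {ω | x < X ω} ≤ C * μ {ω | x + a < X ω}

section TailCharacterization

variable {Ω : Type*} [MeasurableSpace Ω] {μ : Measure Ω} {X : Ω → ℝ}

theorem measure_lt_anti {x y : ℝ} (h : x ≤ y) : μ {ω | y < X ω} ≤ μ {ω | x < X ω} :=
  measure_mono fun _ hω => lt_of_le_of_lt h hω

variable [IsProbabilityMeasure μ]

theorem ofReal_tail_distFun (hX : Measurable X) (x : ℝ) :
    ENNReal.ofReal (tail (distFun μ X) x) = μ {ω | x < X ω} := by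
  have : IsProbabilityMeasure (μ.map X) := Measure.isProbabilityMeasure_map hX.aemeasurable
  have hs : MeasurableSet {ω | X ω ≤ x} := measurableSet_le hX measurable_const
  have h : {ω | x < X ω} = {ω | X ω ≤ x}ᶜ := by ext ω; simp
  rw [tail, distFun, cdf_eq_real, map_measureReal_apply hX measurableSet_Iic, h,
    ← ofReal_measureReal (measure_ne_top _ _), probReal_compl_eq_one_sub hs]
  rfl

theorem tailRatio_distFun (hX : Measurable X) (y x : ℝ) :
    tailRatio (distFun μ X) y x = μ {ω | y < X ω} / μ {ω | x < X ω} := by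
  rw [tailRatio, ofReal_tail_distFun hX, ofReal_tail_distFun hX]

theorem IsOExponential.exists_eventually_le (hX : Measurable X)
    (h : IsOExponential (distFun μ X)) (a : ℝ) :
    ∃ c : ℝ≥0∞, c ≠ 0 ∧ c ≠ ∞ ∧
      ∀ᶠ x in atTop, μ {ω | x + a < X ω} ≠ 0 ∧ c * μ {ω | x < X ω} ≤ μ {ω | x + a < X ω} := by
  obtain ⟨c, hc0, hc⟩ := exists_between (h a).1
  refine ⟨c, hc0.ne', hc.ne_top, ?_⟩
  filter_upwards [eventually_lt_of_lt_liminf hc] with x hx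
  rw [tailRatio_distFun hX] at hx
  -- A quotient with numerator `0` is `0` here, even `0 / 0`, so exceeding `c` forces a positive
  -- tail.
  refine ⟨fun h0 => ?_, ENNReal.mul_le_of_le_div hx.le⟩
  simp [h0] at hx

theorem IsOExponential.measure_lt_ne_zero (hX : Measurable X)
    (h : IsOExponential (distFun μ X)) (x : ℝ) : μ {ω | x < X ω} ≠ 0 := by
  obtain ⟨c, -, -, hc⟩ := h.exists_eventually_le hX 0
  obtain ⟨y, hy, hxy⟩ := (hc.and (eventually_ge_atTop x)).exists
  refine fun h0 => hy.1 (le_antisymm ?_ bot_le)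
  exact (measure_lt_anti (by linarith)).trans_eq h0

theorem IsOExponential.tailShiftBounded (hX : Measurable X)
    (h : IsOExponential (distFun μ X)) : TailShiftBounded μ X := by
  intro a
  obtain ⟨c, hc0, hct, hc⟩ := h.exists_eventually_le hX a
  obtain ⟨y, hy⟩ := eventually_atTop.1 hc
  set q := μ {ω | y + a < X ω}
  have hq : q ≠ 0 := h.measure_lt_ne_zero hX _
  -- `c⁻¹` serves `x ≥ y`; for `x ≤ y` the left side is at most `1` and the shifted tail at least
  -- `q`.
  refine ⟨c⁻¹ + q⁻¹, by simp [hc0, hq], fun x => ?_⟩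
  rcases le_total y x with hxy | hxy
  · calc μ {ω | x < X ω} = c⁻¹ * (c * μ {ω | x < X ω}) := by
          rw [← mul_assoc, ENNReal.inv_mul_cancel hc0 hct, one_mul]
      _ ≤ (c⁻¹ + q⁻¹) * μ {ω | x + a < X ω} := mul_le_mul' le_self_add (hy x hxy).2
  · calc μ {ω | x < X ω} ≤ 1 := prob_le_one
      _ = q⁻¹ * q := (ENNReal.inv_mul_cancel hq (measure_ne_top _ _)).symm
      _ ≤ (c⁻¹ + q⁻¹) * μ {ω | x + a < X ω} :=
          mul_le_mul' le_add_self (measure_lt_anti (by linarith))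

theorem TailShiftBounded.isOExponential (hX : Measurable X) (h : TailShiftBounded μ X)
    (hpos : ∀ x, μ {ω | x < X ω} ≠ 0) : IsOExponential (distFun μ X) := by
  intro a
  simp only [tailRatio_distFun hX]
  refine ⟨?_, liminf_le_limsup, ?_⟩
  · obtain ⟨C, hC, hle⟩ := h a
    refine (ENNReal.inv_pos.2 hC).trans_le (le_liminf_of_le (by isBoundedDefault)
      (Eventually.of_forall fun x => ?_))
    rw [ENNReal.le_div_iff_mul_le (Or.inl (hpos x)) (Or.inl (measure_ne_top _ _)), mul_comm,
      ← div_eq_mul_inv]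
    exact ENNReal.div_le_of_le_mul' (hle x)
  -- The upper bound on the quotient is the opposite shift, started from `x + a`.
  · obtain ⟨C, hC, hle⟩ := h (-a)
    refine lt_of_le_of_lt (limsup_le_of_le (by isBoundedDefault)
      (Eventually.of_forall fun x => ENNReal.div_le_of_le_mul ?_)) hC.lt_top
    simpa using hle (x + a)

end TailCharacterization

/-- A shift bound for the tail of `X` passes, with its constant, to `X + Y` if `Y` is independent
of `X`. -/
theorem measure_lt_add_le_of_indepFun {Ω : Type*} [MeasurableSpace Ω] {μ : Measure Ω}
    [IsProbabilityMeasure μ] {X Y : Ω → ℝ} (hX : Measurable X) (hY : Measurable Y)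
    (hXY : IndepFun X Y μ) {a : ℝ} {C : ℝ≥0∞}
    (h : ∀ x : ℝ, μ {ω | x < X ω} ≤ C * μ {ω | x + a < X ω}) (x : ℝ) :
    μ {ω | x < X ω + Y ω} ≤ C * μ {ω | x + a < X ω + Y ω} := by
  have : IsProbabilityMeasure (μ.map X) := Measure.isProbabilityMeasure_map hX.aemeasurable
  have : IsProbabilityMeasure (μ.map Y) := Measure.isProbabilityMeasure_map hY.aemeasurable
  have hmeas (z : ℝ) : MeasurableSet {p : ℝ × ℝ | z < p.1 + p.2} :=
    measurableSet_lt measurable_const (measurable_fst.add measurable_snd)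
  -- Fubini for the product law: condition on the value of `Y`.
  have key (z : ℝ) :
      μ {ω | z < X ω + Y ω} = ∫⁻ y, μ {ω | z - y < X ω} ∂(μ.map Y) := by
    have h1 : μ {ω | z < X ω + Y ω} =
        μ.map (fun ω => (X ω, Y ω)) {p : ℝ × ℝ | z < p.1 + p.2} := by
      rw [Measure.map_apply (hX.prodMk hY) (hmeas z)]
      rfl
    rw [h1, (indepFun_iff_map_prod_eq_prod_map_map hX.aemeasurable hY.aemeasurable).1 hXY,
      Measure.prod_apply_symm (hmeas z)]
    refine lintegral_congr fun y => ?_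
    rw [Measure.map_apply hX (measurable_prodMk_right (hmeas z))]
    congr 1
    ext ω
    simp [sub_lt_iff_lt_add]
  have hanti (z : ℝ) : Measurable fun y : ℝ => μ {ω | z - y < X ω} :=
    Monotone.measurable fun y y' hy => measure_lt_anti (by linarith)
  rw [key, key, ← lintegral_const_mul _ (hanti _)]
  refine lintegral_mono fun y => (h (x - y)).trans_eq ?_
  rw [sub_add_eq_add_sub]

section RandomSum

variable {Ω : Type*} [MeasurableSpace Ω] {μ : Measure Ω} {ξ : ℕ → Ω → ℝ} {η : Ω → ℕ}

theorem measurable_sum_Icc_one (hξ : ∀ k, 1 ≤ k → Measurable (ξ k)) (n : ℕ) :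
    Measurable fun ω => ∑ k ∈ Finset.Icc 1 n, ξ k ω :=
  Finset.measurable_sum _ fun k hk => hξ k (Finset.mem_Icc.1 hk).1

theorem measurable_randomSum (hξ : ∀ k, 1 ≤ k → Measurable (ξ k)) (hη : Measurable η) :
    Measurable (randomSum ξ η) := by
  have h : Measurable fun p : ℕ × Ω => ∑ k ∈ Finset.Icc 1 p.1, ξ k p.2 :=
    measurable_from_prod_countable_right fun n => measurable_sum_Icc_one hξ n
  exact h.comp (hη.prodMk measurable_id)

theorem sum_Icc_one_eq_sum_range (f : ℕ → ℝ) (n : ℕ) :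
    ∑ k ∈ Finset.Icc 1 n, f k = ∑ k ∈ Finset.range n, f (k + 1) := by
  rw [Finset.range_eq_Ico, Finset.sum_Ico_add' f 0 n 1]
  rfl

theorem measure_eq_inter_lt_sum (hηξ : IndepFun η (fun ω (k : ℕ) => ξ (k + 1) ω) μ) (n : ℕ)
    (x : ℝ) : μ ({ω | η ω = n} ∩ {ω | x < ∑ k ∈ Finset.Icc 1 n, ξ k ω}) =
      μ {ω | η ω = n} * μ {ω | x < ∑ k ∈ Finset.Icc 1 n, ξ k ω} := by
  have hs : MeasurableSet {f : ℕ → ℝ | x < ∑ k ∈ Finset.range n, f k} :=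
    measurableSet_lt measurable_const (Finset.measurable_sum _ fun k _ => measurable_pi_apply k)
  simp only [sum_Icc_one_eq_sum_range]
  exact hηξ.measure_inter_preimage_eq_mul _ _ (MeasurableSet.singleton n) hs

theorem measure_lt_randomSum (hξ : ∀ k, 1 ≤ k → Measurable (ξ k)) (hη : Measurable η)
    (hηξ : IndepFun η (fun ω (k : ℕ) => ξ (k + 1) ω) μ) (x : ℝ) :
    μ {ω | x < randomSum ξ η ω} =
      ∑' n, μ {ω | η ω = n} * μ {ω | x < ∑ k ∈ Finset.Icc 1 n, ξ k ω} := by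
  simp only [← measure_eq_inter_lt_sum hηξ]
  rw [← measure_iUnion]
  · congr 1
    ext ω
    simp [randomSum]
  · intro m n hmn
    refine Set.disjoint_left.2 fun ω hm hn => hmn ?_
    exact hm.1.symm.trans hn.1
  · exact fun n => (hη (MeasurableSet.singleton n)).inter
      (measurableSet_lt measurable_const (measurable_sum_Icc_one hξ n))

theorem measure_lt_sum_le_of_le [IsProbabilityMeasure μ] (hξ : ∀ k, 1 ≤ k → Measurable (ξ k))
    (hindep : iIndepFun (fun k : ℕ => ξ (k + 1)) μ) {κ n : ℕ} (hκ : 1 ≤ κ) (hκn : κ ≤ n)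
    {a : ℝ} {C : ℝ≥0∞} (h : ∀ x : ℝ, μ {ω | x < ξ κ ω} ≤ C * μ {ω | x + a < ξ κ ω}) (x : ℝ) :
    μ {ω | x < ∑ k ∈ Finset.Icc 1 n, ξ k ω} ≤
      C * μ {ω | x + a < ∑ k ∈ Finset.Icc 1 n, ξ k ω} := by
  -- Independence is stated for the family shifted by one, where `ξ κ` has index `j = κ - 1`.
  obtain ⟨j, rfl⟩ := Nat.exists_eq_add_of_le' hκ
  have hmeas (k : ℕ) : Measurable (ξ (k + 1)) := hξ _ (Nat.le_add_left 1 k)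
  have hj : j ∈ Finset.range n := Finset.mem_range.2 hκn
  have hind := (hindep.indepFun_finsetSum_of_notMem hmeas
    (Finset.notMem_erase j (Finset.range n))).symm
  have hsum (ω : Ω) : ∑ k ∈ Finset.Icc 1 n, ξ k ω =
      ξ (j + 1) ω + (∑ k ∈ (Finset.range n).erase j, ξ (k + 1)) ω := by
    rw [sum_Icc_one_eq_sum_range (fun k => ξ k ω), Finset.sum_apply,
      Finset.add_sum_erase _ (fun k => ξ (k + 1) ω) hj]
  simp only [hsum]
  exact measure_lt_add_le_of_indepFun (hmeas j)
    (by fun_prop) hind h x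

theorem measure_lt_sum_mono (hnonneg : ∀ k, 1 ≤ k → ∀ᵐ ω ∂μ, 0 ≤ ξ k ω) {s t : Finset ℕ}
    (hst : s ⊆ t) (ht : ∀ k ∈ t, 1 ≤ k) (x : ℝ) :
    μ {ω | x < ∑ k ∈ s, ξ k ω} ≤ μ {ω | x < ∑ k ∈ t, ξ k ω} := by
  have hall : ∀ᵐ ω ∂μ, ∀ k, 1 ≤ k → 0 ≤ ξ k ω := by
    simpa only [ae_all_iff] using hnonneg
  refine measure_mono_ae ?_
  filter_upwards [hall] with ω hω
  exact fun (hx : x < _) => hx.trans_le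
    (Finset.sum_le_sum_of_subset_of_nonneg hst fun k hk _ => hω k (ht k hk))

/-- If one summand, whose index is attained by `η` with positive probability, has a tail that is
shift-bounded, so has the random sum: the partial sums that contain this summand inherit its
constant, and the shorter ones are dominated by the first that contains it. -/
theorem tailShiftBounded_randomSum [IsProbabilityMeasure μ]
    (hξ : ∀ k, 1 ≤ k → Measurable (ξ k)) (hnonneg : ∀ k, 1 ≤ k → ∀ᵐ ω ∂μ, 0 ≤ ξ k ω)
    (hindep : iIndepFun (fun k : ℕ => ξ (k + 1)) μ) (hη : Measurable η)
    (hηξ : IndepFun η (fun ω (k : ℕ) => ξ (k + 1) ω) μ) {κ : ℕ} (hκ : 1 ≤ κ)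
    (hp : μ {ω | η ω = κ} ≠ 0) (h : TailShiftBounded μ (ξ κ)) :
    TailShiftBounded μ (randomSum ξ η) := by
  intro a
  obtain ⟨C, hC, hle⟩ := h a
  set p := μ {ω | η ω = κ}
  refine ⟨C + C * p⁻¹, by finiteness, fun x => ?_⟩
  set T := μ {ω | x + a < randomSum ξ η ω} with hT
  have hmass : ∑' n, μ {ω | η ω = n} = 1 := by
    have := (measure_iUnion (μ := μ) (f := fun n => {ω | η ω = n})
      (fun m n hmn => Set.disjoint_left.2 fun ω hm hn => hmn (hm.symm.trans hn))
      (fun n => hη (MeasurableSet.singleton n))).symm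
    rw [this, ← measure_univ (μ := μ)]
    congr 1
    ext ω
    simp
  -- Keep only the term `n = κ` of the series for `T`.
  have hκT : μ {ω | x + a < ∑ k ∈ Finset.Icc 1 κ, ξ k ω} ≤ p⁻¹ * T := by
    rw [mul_comm, ← div_eq_mul_inv,
      ENNReal.le_div_iff_mul_le (Or.inl hp) (Or.inl (measure_ne_top _ _)), mul_comm, hT,
      measure_lt_randomSum hξ hη hηξ]
    exact ENNReal.le_tsum
      (f := fun n => μ {ω | η ω = n} * μ {ω | x + a < ∑ k ∈ Finset.Icc 1 n, ξ k ω}) κ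
  have hterm (n : ℕ) : μ {ω | x < ∑ k ∈ Finset.Icc 1 n, ξ k ω} ≤
      C * μ {ω | x + a < ∑ k ∈ Finset.Icc 1 n, ξ k ω} + C * (p⁻¹ * T) := by
    rcases le_total κ n with hn | hn
    · exact (measure_lt_sum_le_of_le hξ hindep hκ hn hle x).trans le_self_add
    · calc μ {ω | x < ∑ k ∈ Finset.Icc 1 n, ξ k ω}
          ≤ μ {ω | x < ∑ k ∈ Finset.Icc 1 κ, ξ k ω} :=
            measure_lt_sum_mono hnonneg (Finset.Icc_subset_Icc_right hn)
              (fun k hk => (Finset.mem_Icc.1 hk).1) x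
        _ ≤ C * μ {ω | x + a < ∑ k ∈ Finset.Icc 1 κ, ξ k ω} :=
            measure_lt_sum_le_of_le hξ hindep hκ le_rfl hle x
        _ ≤ C * (p⁻¹ * T) := mul_le_mul_right hκT C
        _ ≤ _ := le_add_self
  calc μ {ω | x < randomSum ξ η ω}
      = ∑' n, μ {ω | η ω = n} * μ {ω | x < ∑ k ∈ Finset.Icc 1 n, ξ k ω} :=
        measure_lt_randomSum hξ hη hηξ x
    _ ≤ ∑' n, (C * (μ {ω | η ω = n} * μ {ω | x + a < ∑ k ∈ Finset.Icc 1 n, ξ k ω}) +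
          μ {ω | η ω = n} * (C * (p⁻¹ * T))) := by
        refine ENNReal.tsum_le_tsum fun n => (mul_le_mul_right (hterm n) _).trans_eq ?_
        rw [mul_add, mul_left_comm]
    _ = (C + C * p⁻¹) * T := by
        rw [ENNReal.tsum_add, ENNReal.tsum_mul_left, ENNReal.tsum_mul_right, hmass,
          ← measure_lt_randomSum hξ hη hηξ, one_mul, add_mul, mul_assoc]

theorem measure_lt_randomSum_ne_zero (hξ : ∀ k, 1 ≤ k → Measurable (ξ k))
    (hnonneg : ∀ k, 1 ≤ k → ∀ᵐ ω ∂μ, 0 ≤ ξ k ω) (hη : Measurable η)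
    (hηξ : IndepFun η (fun ω (k : ℕ) => ξ (k + 1) ω) μ) {κ : ℕ} (hκ : 1 ≤ κ)
    (hp : μ {ω | η ω = κ} ≠ 0) {x : ℝ} (hx : μ {ω | x < ξ κ ω} ≠ 0) :
    μ {ω | x < randomSum ξ η ω} ≠ 0 := by
  rw [measure_lt_randomSum hξ hη hηξ]
  refine fun h0 => mul_ne_zero hp (fun h => hx ?_) (ENNReal.tsum_eq_zero.1 h0 κ)
  refine le_antisymm (le_trans ?_ h.le) bot_le
  simpa using measure_lt_sum_mono hnonneg (s := {κ}) (t := Finset.Icc 1 κ) (by simpa using hκ)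
    (fun k hk => (Finset.mem_Icc.1 hk).1) x

end RandomSum

theorem theorem6 {Ω : Type*} [MeasurableSpace Ω] (μ : Measure Ω) [IsProbabilityMeasure μ]
    (ξ : ℕ → Ω → ℝ) (η : Ω → ℕ)
    -- `ξ 1, ξ 2, …` are independent nonnegative random variables
    (hξ_meas : ∀ k, 1 ≤ k → Measurable (ξ k))
    (hξ_nonneg : ∀ k, 1 ≤ k → ∀ᵐ ω ∂μ, 0 ≤ ξ k ω)
    (hξ_indep : iIndepFun (fun k : ℕ => ξ (k + 1)) μ)
    -- `η` is a counting random variable, independent of the whole sequence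
    (hη : IsCountingVariable μ η)
    (hηξ : IndepFun η (fun ω (k : ℕ) => ξ (k + 1) ω) μ)
    -- first condition
    (κ : ℕ) (hκ : κ ∈ countingSupp μ η \ {0})
    (h1 : IsOExponential (distFun μ (ξ κ)))
    -- second condition
    (h2 : ∀ k ∈ countingSupp μ η, 1 ≤ k → k ≤ κ →
      Tendsto (fun x : ℝ => tail (distFun μ (ξ k)) x / tail (distFun μ (ξ κ)) x) atTop (𝓝 0) ∨
        IsOExponential (distFun μ (ξ k)))
    -- third condition
    (h3 : limsup (fun x : ℝ => ⨆ (k : ℕ) (_ : 1 ≤ k),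
      tailRatio (distFun μ (ξ (κ + k))) (x - 1) x) atTop < ∞)
    -- fourth condition
    (h4 : limsup (fun k : ℕ => (1 / (k : ℝ≥0∞)) * ∑ l ∈ Finset.Icc 1 k,
      ⨆ (x : ℝ) (_ : 0 ≤ x), ENNReal.ofReal
        (tail (distFun μ (ξ (κ + l))) (x - 1) - tail (distFun μ (ξ (κ + l))) x)) atTop < 1)
    -- fifth condition
    (h5 : ∀ δ ∈ Set.Ioo (0 : ℝ) 1,
      (fun x : ℝ => tail (distFun μ (fun ω => (η ω : ℝ))) (δ * x)) =O[atTop]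
        (fun x : ℝ => √x * tail (distFun μ (ξ κ)) x)) :
    IsOExponential (distFun μ (randomSum ξ η)) := by
  have hκ1 : 1 ≤ κ := Nat.one_le_iff_ne_zero.2 hκ.2
  have hp : μ {ω | η ω = κ} ≠ 0 := ne_of_gt hκ.1
  have hm := hξ_meas κ hκ1
  exact (tailShiftBounded_randomSum hξ_meas hξ_nonneg hξ_indep hη.measurable hηξ hκ1 hp
    (h1.tailShiftBounded hm)).isOExponential (measurable_randomSum hξ_meas hη.measurable)
    fun x => measure_lt_randomSum_ne_zero hξ_meas hξ_nonneg hη.measurable hηξ hκ1 hp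
      (h1.measure_lt_ne_zero hm x)
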